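/- Broadcasting in a finite simple connected graph $G$ starts from one informed vertex $u$ (the originator) and proceeds in discrete time units. In each time unit any number of calls take place in parallel; each call goes from an informed vertex to an uninformed neighbour, which thereby becomes informed, and each vertex participates in at most one call per time unit. Let $b(u)$ be the minimum number of time units after which all vertices can be informed, starting from $u$, and let $b(G)=\max_{u} b(u)$. A connected graph $G$ on $n$ vertices is a broadcast graph if $b(G)=\lceil\log_2 n\rceil$, and $B(n)$ is the minimum number of edges of a broadcast graph on $n$ vertices. Theorem. Let $t,k,n$ be positive integers with $t\ge 7$ and $2\le k\le\lfloor t/2\rfloor-1$; if $n$ is odd, it is enough that $2\le k\le\lceil t/2\rceil-1$. Let $N=(2^k-1)2^{t+1-k}$. 1. If $n=N$, then $$B(n)\le (k+1)N-\Bigl(t-\frac k2+2\Bigr)2^k+t-k+2.$$ 2. If $2^t<n<N$, then $$B(n)\le (k+1-p)\,n-\Bigl(t-\frac k2+p+2\Bigr)2^k+t-k-(p-2)2^p,$$ where $d=N-n$, $x=\lfloor d/2^{t+1-k}\rfloor$, and $p=\lfloor\log_2(x+1)\rfloor$ if $x>0$, $p=0$ otherwise. -/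

import Mathlib

namespace Broadcast

/-- A call `c = (a, b)` is placed by `a` and received by `b`; `Participates v c` says that
`v` is one of its two parties. -/
def Participates {V : Type*} (v : V) (c : V × V) : Prop := v = c.1 ∨ v = c.2

/-- `Step G S S'`: in one time unit the set of informed vertices can pass from `S` to `S'`.
Finitely or infinitely many calls are made in parallel; each goes from an informed vertex to an
uninformed neighbour, and no vertex participates in two different calls. -/
def Step {V : Type*} (G : SimpleGraph V) (S S' : Set V) : Prop :=
  ∃ C : Set (V × V),
    (∀ c ∈ C, c.1 ∈ S ∧ c.2 ∉ S ∧ G.Adj c.1 c.2) ∧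
    (∀ c ∈ C, ∀ c' ∈ C, ∀ v, Participates v c → Participates v c' → c = c') ∧
    S' = S ∪ Prod.snd '' C

/-- Broadcasting from the originator `u` can be completed in `τ` time units; `I i` is the set of
vertices informed after `i` time units. -/
def CompletesIn {V : Type*} (G : SimpleGraph V) (u : V) (τ : ℕ) : Prop :=
  ∃ I : ℕ → Set V, I 0 = {u} ∧ (∀ i < τ, Step G (I i) (I (i + 1))) ∧ I τ = Set.univ

/-- The broadcast time `b(u)`: the least number of time units in which broadcasting from `u` can
be completed (`⊤` if it cannot be completed at all). -/
noncomputable def vertexTime {V : Type*} (G : SimpleGraph V) (u : V) : ℕ∞ :=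
  ⨅ τ ∈ {τ : ℕ | CompletesIn G u τ}, (τ : ℕ∞)

/-- The broadcast time `b(G) = max_u b(u)` of a graph. -/
noncomputable def graphTime {V : Type*} (G : SimpleGraph V) : ℕ∞ :=
  ⨆ u, vertexTime G u

/-- A broadcast graph on `n` vertices: connected, with `b(G) = ⌈log₂ n⌉`. -/
def IsBroadcastGraph {n : ℕ} (G : SimpleGraph (Fin n)) : Prop :=
  G.Connected ∧ graphTime G = (Nat.clog 2 n : ℕ∞)

/-- The numbers of edges of the broadcast graphs on `n` vertices. -/
def sizes (n : ℕ) : Set ℕ :=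
  {e | ∃ G : SimpleGraph (Fin n), IsBroadcastGraph G ∧ G.edgeSet.ncard = e}

/-- The broadcast number `B(n)`: the minimum number of edges of a broadcast graph on `n`
vertices (a genuine minimum whenever `sizes n` is nonempty). -/
noncomputable def B (n : ℕ) : ℕ := sInf (sizes n)

end Broadcast

namespace Broadcast

open Set

variable {V W : Type*}

/-- `Reach G m A B`: in `m` time units the set of informed vertices can pass from `A` to `B`. -/
def Reach (G : SimpleGraph V) (m : ℕ) (A B : Set V) : Prop :=
  ∃ I : ℕ → Set V, I 0 = A ∧ (∀ i < m, Step G (I i) (I (i + 1))) ∧ I m = B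

theorem Step.subset {G : SimpleGraph V} {A B : Set V} (h : Step G A B) : A ⊆ B := by
  obtain ⟨C, -, -, rfl⟩ := h
  exact subset_union_left

/-- A step is given by a function that is injective on the newly informed vertices and sends each
of them to an informed neighbour. -/
theorem Step.of_caller {G : SimpleGraph V} {A B : Set V} (hAB : A ⊆ B) (c : V → V)
    (hc : ∀ v ∈ B, v ∉ A → c v ∈ A ∧ G.Adj (c v) v)
    (hinj : ∀ v ∈ B, v ∉ A → ∀ w ∈ B, w ∉ A → c v = c w → v = w) : Step G A B := by
  refine ⟨(fun v => (c v, v)) '' (B \ A), ?_, ?_, ?_⟩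
  · rintro _ ⟨v, ⟨hv, hv'⟩, rfl⟩
    exact ⟨(hc v hv hv').1, hv', (hc v hv hv').2⟩
  · rintro _ ⟨v, ⟨hv, hv'⟩, rfl⟩ _ ⟨w, ⟨hw, hw'⟩, rfl⟩ x hx hx'
    have h1 := (hc v hv hv').1
    have h2 := (hc w hw hw').1
    rcases hx with hx | hx <;> rcases hx' with hx' | hx' <;> simp only at hx hx'
    · rw [hinj v hv hv' w hw hw' (hx.symm.trans hx')]
    · exact absurd (hx' ▸ hx ▸ h1) hw'
    · exact absurd (hx ▸ hx' ▸ h2) hv'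
    · rw [← hx, ← hx']
  · ext v
    by_cases hv : v ∈ A
    · simp [hv, hAB hv]
    · simp [hv]

theorem Reach.of_family {G : SimpleGraph V} {m : ℕ} (I : ℕ → Set V)
    (h : ∀ i < m, Step G (I i) (I (i + 1))) : Reach G m (I 0) (I m) := ⟨I, rfl, h, rfl⟩

theorem Reach.of_step {G : SimpleGraph V} {A B : Set V} (h : Step G A B) : Reach G 1 A B := by
  refine ⟨fun i => if i = 0 then A else B, by simp, ?_, by simp⟩
  intro i hi
  obtain rfl : i = 0 := by omega
  simpa using h

theorem Reach.trans {G : SimpleGraph V} {m m' : ℕ} {A B C : Set V} (h : Reach G m A B)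
    (h' : Reach G m' B C) : Reach G (m + m') A C := by
  obtain ⟨I, hI0, hI, hIm⟩ := h
  obtain ⟨J, hJ0, hJ, hJm⟩ := h'
  refine ⟨fun i => if i ≤ m then I i else J (i - m), by simpa using hI0, ?_, ?_⟩
  · intro i hi
    rcases lt_trichotomy i m with him | rfl | him
    · simpa [him.le, Nat.succ_le_of_lt him] using hI i him
    · have := hJ 0 (by omega)
      simpa [hIm, ← hJ0] using this
    · have := hJ (i - m) (by omega)
      have e : i + 1 - m = i - m + 1 := by omega
      simpa [him.not_ge, show ¬ i + 1 ≤ m by omega, e] using this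
  · rcases Nat.eq_zero_or_pos m' with rfl | hm'
    · simp [hIm, ← hJm, hJ0]
    · simp [show ¬ m' = 0 by omega, hJm]

/-- A spread that stays within the range of an embedding can be carried out in the pulled-back
graph. -/
theorem Reach.completesIn_comap {G : SimpleGraph V} (e : W ↪ V) {u : W} {m : ℕ}
    (h : Reach G m {e u} (range e)) : CompletesIn (G.comap e) u m := by
  obtain ⟨I, hI0, hI, hIm⟩ := h
  have hsub : ∀ j ≤ m, I (m - j) ⊆ range e := by
    intro j
    induction j with
    | zero => intro _; simp [hIm]
    | succ j ih =>
      intro hj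
      refine Subset.trans ?_ (ih (by omega))
      have := (hI (m - (j + 1)) (by omega)).subset
      rwa [show m - (j + 1) + 1 = m - j by omega] at this
  refine ⟨fun i => e ⁻¹' I i, ?_, ?_, ?_⟩
  · ext w; simp [hI0]
  · intro i hi
    obtain ⟨C, hC, hC', hS⟩ := hI i hi
    have hr : I (i + 1) ⊆ range e := by
      have := hsub (m - (i + 1)) (by omega)
      rwa [show m - (m - (i + 1)) = i + 1 by omega] at this
    refine ⟨{c | (e c.1, e c.2) ∈ C}, ?_, ?_, ?_⟩
    · intro c hc
      exact hC _ hc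
    · intro c hc c' hc' v hv hv'
      have := hC' _ hc _ hc' (e v) (by
        rcases hv with hv | hv <;> simp [Participates, hv]) (by
        rcases hv' with hv' | hv' <;> simp [Participates, hv'])
      simp only [Prod.mk.injEq, e.injective.eq_iff] at this
      exact Prod.ext this.1 this.2
    · ext w
      simp only [hS, mem_preimage, mem_union, mem_image, mem_ofPred_eq, Prod.exists,
        exists_eq_right]
      refine or_congr_right ⟨?_, ?_⟩
      · rintro ⟨a, ha⟩
        have : a ∈ range e := hr (by rw [hS]; exact Or.inl (hC _ ha).1)
        obtain ⟨a, rfl⟩ := this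
        exact ⟨a, ha⟩
      · rintro ⟨a, ha⟩
        exact ⟨_, ha⟩
  · simp [hIm]

theorem Step.ncard_le [Finite V] {G : SimpleGraph V} {A B : Set V} (h : Step G A B) :
    B.ncard ≤ 2 * A.ncard := by
  obtain ⟨C, hC, hC', rfl⟩ := h
  have h1 : (Prod.snd '' C).ncard ≤ C.ncard := ncard_image_le
  have h2 : C.ncard ≤ A.ncard := by
    refine ncard_le_ncard_of_injOn Prod.fst (fun c hc => (hC c hc).1) ?_
    intro c hc c' hc' hcc
    exact hC' c hc c' hc' c.1 (Or.inl rfl) (Or.inl hcc)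
  have := ncard_union_le A (Prod.snd '' C)
  omega

theorem CompletesIn.card_le [Finite V] {G : SimpleGraph V} {u : V} {m : ℕ}
    (h : CompletesIn G u m) : Nat.card V ≤ 2 ^ m := by
  obtain ⟨I, hI0, hI, hIm⟩ := h
  have : ∀ i ≤ m, (I i).ncard ≤ 2 ^ i := by
    intro i
    induction i with
    | zero => simp [hI0]
    | succ i ih =>
      intro hi
      have h1 := (hI i (by omega)).ncard_le
      have h2 := ih (by omega)
      rw [pow_succ]
      omega
  simpa [hIm, ncard_univ] using this m le_rfl

theorem CompletesIn.reachable {G : SimpleGraph V} {u : V} {m : ℕ}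
    (h : CompletesIn G u m) (v : V) : G.Reachable u v := by
  obtain ⟨I, hI0, hI, hIm⟩ := h
  have : ∀ i ≤ m, ∀ v ∈ I i, G.Reachable u v := by
    intro i
    induction i with
    | zero => intro _ v hv; rw [hI0] at hv; rw [hv]
    | succ i ih =>
      intro hi v hv
      obtain ⟨C, hC, -, hS⟩ := hI i (by omega)
      rw [hS] at hv
      rcases hv with hv | ⟨c, hc, rfl⟩
      · exact ih (by omega) v hv
      · exact (ih (by omega) _ (hC c hc).1).trans (hC c hc).2.2.reachable
  exact this m le_rfl v (by simp [hIm])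

theorem IsBroadcastGraph.of_completesIn {n : ℕ} {G : SimpleGraph (Fin n)} (hn : 0 < n)
    (h : ∀ u, CompletesIn G u (Nat.clog 2 n)) : IsBroadcastGraph G := by
  have hv : ∀ u, vertexTime G u = (Nat.clog 2 n : ℕ∞) := by
    intro u
    refine le_antisymm (iInf₂_le _ (h u)) (le_iInf₂ fun τ hτ => ?_)
    have := CompletesIn.card_le hτ
    rw [Nat.card_eq_fintype_card, Fintype.card_fin] at this
    exact_mod_cast Nat.clog_le_of_le_pow this
  have : Nonempty (Fin n) := ⟨⟨0, hn⟩⟩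
  refine ⟨⟨fun u v => (h u).reachable v⟩, ?_⟩
  simp [graphTime, hv]

/-- A vertex `(z, y, a)`: the pair `(z, y)` is a vertex of a `(q + P)`-dimensional cube, and `a` is
a vertex of the binomial tree of dimension `s` attached to it; the root of that tree is `a = ∅`. -/
abbrev Vtx (q P s : ℕ) := Finset (Fin q) × Finset (Fin P) × Finset (Fin s)

variable {q P s : ℕ}

/-- The parent of a vertex of a binomial tree. -/
def parent (a : Finset (Fin s)) : Finset (Fin s) :=
  if h : a.Nonempty then a.erase (a.max' h) else a

/-- The edges of the binomial trees. -/
def treeEdges (S : Finset (Vtx q P s)) : Finset (Sym2 (Vtx q P s)) :=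
  {v ∈ S | v.2.2.Nonempty}.image fun v => s(v, (v.1, v.2.1, parent v.2.2))

/-- The edges joining vertices of depth at least two to the root of their tree. -/
def shortcutEdges (S : Finset (Vtx q P s)) : Finset (Sym2 (Vtx q P s)) :=
  {v ∈ S | 2 ≤ v.2.2.card}.image fun v => s(v, (v.1, v.2.1, ∅))

/-- The edges joining a non-root vertex `(z, y, a)` to the roots `({j}, y, ∅)`, `j ≠ piv z`. -/
def linkEdges (piv : Finset (Fin q) → Fin q) (S : Finset (Vtx q P s)) :
    Finset (Sym2 (Vtx q P s)) :=
  {v ∈ S | v.2.2.Nonempty}.biUnion fun v =>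
    (Finset.univ.erase (piv v.1)).image fun j => s(v, ({j}, v.2.1, ∅))

/-- The edges between roots in the directions of the first cube, the vertex `∅` of which is
deleted. -/
def outerEdges (q P s : ℕ) : Finset (Sym2 (Vtx q P s)) :=
  Finset.univ.biUnion fun j =>
    (({z : Finset (Fin q) | j ∈ z} : Finset _).erase {j} ×ˢ Finset.univ).image
      fun x => s((x.1, x.2, ∅), (x.1.erase j, x.2, ∅))

/-- The edges between roots in the directions of the second cube. -/
def innerEdges (q P s : ℕ) : Finset (Sym2 (Vtx q P s)) :=
  Finset.univ.biUnion fun j =>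
    ((Finset.univ.erase ∅) ×ˢ ({y : Finset (Fin P) | j ∈ y} : Finset _)).image
      fun x => s((x.1, x.2, ∅), (x.1, x.2.erase j, ∅))

/-- All edges of the construction with vertex set `S`. -/
def allEdges (piv : Finset (Fin q) → Fin q) (S : Finset (Vtx q P s)) :
    Finset (Sym2 (Vtx q P s)) :=
  treeEdges S ∪ shortcutEdges S ∪ linkEdges piv S ∪ outerEdges q P s ∪ innerEdges q P s

/-- The graph of the construction with vertex set `S`. -/
def treeCube (piv : Finset (Fin q) → Fin q) (S : Finset (Vtx q P s)) : SimpleGraph (Vtx q P s) :=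
  SimpleGraph.fromEdgeSet (allEdges piv S : Set (Sym2 (Vtx q P s)))

/-- The vertex sets used: they hold all vertices of depth at most one, hold no vertex over `z = ∅`,
and cut every binomial tree down to a subtree. -/
structure IsAdmissible (S : Finset (Vtx q P s)) : Prop where
  nonempty : ∀ v ∈ S, v.1.Nonempty
  mem_of_card_le : ∀ v : Vtx q P s, v.1.Nonempty → v.2.2.card ≤ 1 → v ∈ S
  erase_mem : ∀ v ∈ S, ∀ j, ((v.1, v.2.1, v.2.2.erase j) : Vtx q P s) ∈ S

theorem IsAdmissible.root_mem {S : Finset (Vtx q P s)} (hS : IsAdmissible S)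
    {z : Finset (Fin q)} (hz : z.Nonempty) (y : Finset (Fin P)) : (z, y, ∅) ∈ S :=
  hS.mem_of_card_le _ hz (by simp)

/-! ### Adjacency -/

section Adj

variable {piv : Finset (Fin q) → Fin q} {S : Finset (Vtx q P s)}

theorem parent_ne {a : Finset (Fin s)} (ha : a.Nonempty) : parent a ≠ a := by
  rw [parent, dif_pos ha]
  exact (Finset.erase_ssubset (a.max'_mem ha)).ne

theorem parent_eq {a : Finset (Fin s)} {i : Fin s} (hi : i ∈ a) (h : ∀ j ∈ a, j ≤ i) :
    parent a = a.erase i := by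
  have ha : a.Nonempty := ⟨i, hi⟩
  rw [parent, dif_pos ha, le_antisymm (a.max'_le ha i h) (a.le_max' i hi)]

theorem adj_parent {z : Finset (Fin q)} {y : Finset (Fin P)} {a : Finset (Fin s)}
    (hv : (z, y, a) ∈ S) (ha : a.Nonempty) : (treeCube piv S).Adj (z, y, parent a) (z, y, a) := by
  refine SimpleGraph.Adj.symm ?_
  rw [treeCube, SimpleGraph.fromEdgeSet_adj]
  constructor
  · simp only [allEdges, Finset.coe_union]
    refine Or.inl (Or.inl (Or.inl (Or.inl ?_)))
    exact Finset.mem_image.2 ⟨(z, y, a), Finset.mem_filter.2 ⟨hv, ha⟩, rfl⟩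
  · simpa using (parent_ne ha).symm

theorem adj_root {z : Finset (Fin q)} {y : Finset (Fin P)} {a : Finset (Fin s)}
    (hv : (z, y, a) ∈ S) (ha : a.Nonempty) : (treeCube piv S).Adj (z, y, a) (z, y, ∅) := by
  rcases Nat.lt_or_ge a.card 2 with h | h
  · have h1 : a.card = 1 := by have := ha.card_pos; omega
    obtain ⟨i, rfl⟩ := Finset.card_eq_one.1 h1
    have := adj_parent (piv := piv) hv ha
    rw [parent_eq (i := i) (by simp) (by simp)] at this
    simpa using this.symm
  · rw [treeCube, SimpleGraph.fromEdgeSet_adj]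
    constructor
    · simp only [allEdges, Finset.coe_union]
      refine Or.inl (Or.inl (Or.inl (Or.inr ?_)))
      exact Finset.mem_image.2 ⟨(z, y, a), Finset.mem_filter.2 ⟨hv, h⟩, rfl⟩
    · simpa using ha.ne_empty

theorem adj_link {z : Finset (Fin q)} {y : Finset (Fin P)} {a : Finset (Fin s)} {j : Fin q}
    (hv : (z, y, a) ∈ S) (ha : a.Nonempty) (hj : j ≠ piv z) :
    (treeCube piv S).Adj (z, y, a) ({j}, y, ∅) := by
  rw [treeCube, SimpleGraph.fromEdgeSet_adj]
  constructor
  · simp only [allEdges, Finset.coe_union]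
    refine Or.inl (Or.inl (Or.inr ?_))
    refine Finset.mem_biUnion.2 ⟨(z, y, a), Finset.mem_filter.2 ⟨hv, ha⟩, ?_⟩
    exact Finset.mem_image.2 ⟨j, by simpa using hj, rfl⟩
  · simp [ha.ne_empty]

theorem adj_outer_erase {z : Finset (Fin q)} (y : Finset (Fin P)) {j : Fin q} (hj : j ∈ z)
    (hz : (z.erase j).Nonempty) : (treeCube piv S).Adj (z, y, ∅) (z.erase j, y, ∅) := by
  rw [treeCube, SimpleGraph.fromEdgeSet_adj]
  constructor
  · simp only [allEdges, Finset.coe_union]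
    refine Or.inl (Or.inr ?_)
    refine Finset.mem_biUnion.2 ⟨j, Finset.mem_univ _, ?_⟩
    refine Finset.mem_image.2 ⟨(z, y), ?_, rfl⟩
    have : z ≠ {j} := by rintro rfl; simp at hz
    simp [hj, this]
  · intro h
    simp only [Prod.mk.injEq, and_true] at h
    exact Finset.notMem_erase j z (h ▸ hj)

theorem adj_inner_erase {z : Finset (Fin q)} {y : Finset (Fin P)} {j : Fin P} (hj : j ∈ y)
    (hz : z.Nonempty) : (treeCube piv S).Adj (z, y, ∅) (z, y.erase j, ∅) := by
  rw [treeCube, SimpleGraph.fromEdgeSet_adj]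
  constructor
  · simp only [allEdges, Finset.coe_union]
    refine Or.inr ?_
    refine Finset.mem_biUnion.2 ⟨j, Finset.mem_univ _, ?_⟩
    refine Finset.mem_image.2 ⟨(z, y), ?_, rfl⟩
    simp [hj, hz.ne_empty]
  · intro h
    simp only [Prod.mk.injEq, and_true, true_and] at h
    exact Finset.notMem_erase j y (h ▸ hj)

/-- The neighbour of a vertex of a cube in direction `j`. -/
def flip {m : ℕ} (j : Fin m) (z : Finset (Fin m)) : Finset (Fin m) :=
  if j ∈ z then z.erase j else insert j z

theorem mem_flip {m : ℕ} {j i : Fin m} {z : Finset (Fin m)} :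
    i ∈ flip j z ↔ (i = j ∧ j ∉ z) ∨ (i ≠ j ∧ i ∈ z) := by
  unfold flip
  split_ifs with h <;> by_cases hij : i = j <;> simp [*]

theorem flip_flip {m : ℕ} (j : Fin m) (z : Finset (Fin m)) : flip j (flip j z) = z := by
  ext i
  by_cases hij : i = j <;> simp [mem_flip, hij]

theorem flip_injective {m : ℕ} (j : Fin m) : Function.Injective (flip j) :=
  Function.LeftInverse.injective (flip_flip j)

theorem adj_outer {z : Finset (Fin q)} (y : Finset (Fin P)) {j : Fin q} (hz : z.Nonempty)
    (hz' : (flip j z).Nonempty) : (treeCube piv S).Adj (flip j z, y, ∅) (z, y, ∅) := by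
  by_cases hj : j ∈ z
  · rw [flip, if_pos hj] at hz' ⊢
    exact (adj_outer_erase y hj hz').symm
  · rw [flip, if_neg hj]
    have := adj_outer_erase (piv := piv) (S := S) y (Finset.mem_insert_self j z)
      (by rwa [Finset.erase_insert hj])
    rwa [Finset.erase_insert hj] at this

theorem adj_inner {z : Finset (Fin q)} (y : Finset (Fin P)) (j : Fin P) (hz : z.Nonempty) :
    (treeCube piv S).Adj (z, flip j y, ∅) (z, y, ∅) := by
  by_cases hj : j ∈ y
  · rw [flip, if_pos hj]
    exact (adj_inner_erase hj hz).symm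
  · rw [flip, if_neg hj]
    have := adj_inner_erase (piv := piv) (S := S) (Finset.mem_insert_self j y) hz
    rwa [Finset.erase_insert hj] at this

end Adj

/-! ### Broadcasting -/

section Scheme

variable {piv : Finset (Fin q) → Fin q} {S : Finset (Vtx q P s)}

/-- From the roots, the message spreads down the binomial trees. -/
theorem reach_tree (hS : IsAdmissible S) (u : Vtx q P s) :
    Reach (treeCube piv S) s {v | v ∈ S ∧ (v = u ∨ v.2.2 = ∅)} {v | v ∈ S} := by
  have key := Reach.of_family (G := treeCube piv S) (m := s)
    (fun i => {v : Vtx q P s | v ∈ S ∧ (v = u ∨ ∀ j ∈ v.2.2, j.val < i)}) ?_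
  · convert key using 1
    · ext ⟨z, y, a⟩
      simp [Finset.eq_empty_iff_forall_notMem]
    · ext ⟨z, y, a⟩
      simp
  intro i hi
  refine Step.of_caller ?_ (fun v => (v.1, v.2.1, v.2.2.erase ⟨i, hi⟩)) ?_ ?_
  · rintro v ⟨hv, h⟩
    exact ⟨hv, h.imp_right fun h j hj => (h j hj).trans (Nat.lt_succ_self i)⟩
  all_goals
    have key : ∀ v : Vtx q P s, v ∈ S ∧ (v = u ∨ ∀ j ∈ v.2.2, j.val < i + 1) →
        ¬ (v ∈ S ∧ (v = u ∨ ∀ j ∈ v.2.2, j.val < i)) →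
        (⟨i, hi⟩ : Fin s) ∈ v.2.2 ∧ ∀ j ∈ v.2.2, j ≤ ⟨i, hi⟩ := by
      rintro v ⟨hv, h⟩ h'
      have hne : ¬ v = u := fun e => h' ⟨hv, Or.inl e⟩
      have h1 := h.resolve_left hne
      have h2 : ¬ ∀ j ∈ v.2.2, j.val < i := fun e => h' ⟨hv, Or.inr e⟩
      push Not at h2
      obtain ⟨j, hj, hij⟩ := h2
      have : j = ⟨i, hi⟩ := Fin.ext (le_antisymm (Nat.lt_succ_iff.1 (h1 j hj)) hij)
      exact ⟨this ▸ hj, fun k hk => Nat.lt_succ_iff.1 (h1 k hk)⟩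
  · rintro ⟨z, y, a⟩ hv hv'
    obtain ⟨h1, h2⟩ := key _ hv hv'
    refine ⟨⟨hS.erase_mem _ hv.1 _, Or.inr fun j hj => ?_⟩, ?_⟩
    · have h3 := h2 j (Finset.mem_of_mem_erase hj)
      exact lt_of_le_of_ne h3 fun e => Finset.ne_of_mem_erase hj (Fin.ext e)
    · have := adj_parent (piv := piv) hv.1 ⟨_, h1⟩
      rwa [parent_eq h1 h2] at this
  · rintro ⟨z, y, a⟩ hv hv' ⟨z', y', a'⟩ hw hw' h
    have h1 := (key _ hv hv').1
    have h2 := (key _ hw hw').1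
    simp only [Prod.mk.injEq] at h
    obtain ⟨rfl, rfl, h⟩ := h
    simp only at h1 h2
    rw [← Finset.insert_erase h1, ← Finset.insert_erase h2, h]

/-- From the roots over one vertex of the second cube, the message spreads to all roots. -/
theorem reach_inner (hS : IsAdmissible S) (u : Vtx q P s) (y₀ : Finset (Fin P)) :
    Reach (treeCube piv S) P {v | v ∈ S ∧ (v = u ∨ (v.2.2 = ∅ ∧ v.2.1 = y₀))}
      {v | v ∈ S ∧ (v = u ∨ v.2.2 = ∅)} := by
  have key := Reach.of_family (G := treeCube piv S) (m := P)
    (fun i => {v : Vtx q P s | v ∈ S ∧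
      (v = u ∨ (v.2.2 = ∅ ∧ ∀ j : Fin P, i ≤ j.val → (j ∈ v.2.1 ↔ j ∈ y₀)))}) ?_
  · convert key using 1
    · ext ⟨z, y, a⟩
      simp [Finset.ext_iff]
    · ext ⟨z, y, a⟩
      simp [Fin.is_lt, Nat.not_le.2]
  intro i hi
  refine Step.of_caller ?_ (fun v => (v.1, flip ⟨i, hi⟩ v.2.1, v.2.2)) ?_ ?_
  · rintro v ⟨hv, h⟩
    exact ⟨hv, h.imp_right fun h => ⟨h.1, fun j hj => h.2 j (by omega)⟩⟩
  · rintro ⟨z, y, a⟩ ⟨hv, h⟩ h'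
    have hne : ¬ (z, y, a) = u := fun e => h' ⟨hv, Or.inl e⟩
    obtain ⟨rfl, h1⟩ := h.resolve_left hne
    have hz := hS.nonempty _ hv
    refine ⟨⟨hS.root_mem hz _, Or.inr ⟨rfl, ?_⟩⟩, adj_inner _ _ hz⟩
    have h2 : ¬ ((⟨i, hi⟩ : Fin P) ∈ y ↔ ⟨i, hi⟩ ∈ y₀) := by
      intro h2
      refine h' ⟨hv, Or.inr ⟨rfl, fun j hj => ?_⟩⟩
      rcases hj.eq_or_lt with rfl | hj
      · exact h2
      · exact h1 j hj
    intro j hj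
    rw [mem_flip]
    by_cases e : j = ⟨i, hi⟩
    · subst e
      simp only at h2 ⊢
      tauto
    · have := h1 j (lt_of_le_of_ne hj fun e' => e (Fin.ext e'.symm))
      simp only at this
      tauto
  · rintro ⟨z, y, a⟩ - - ⟨z', y', a'⟩ - - h
    simp only [Prod.mk.injEq] at h ⊢
    exact ⟨h.1, flip_injective _ h.2.1, h.2.2⟩

/-- From a root, the message spreads to all roots over the same vertex of the second cube. -/
theorem reach_outer_of_root (hpiv : ∀ z : Finset (Fin q), z.Nonempty → piv z ∈ z)
    (hS : IsAdmissible S) {z₀ : Finset (Fin q)} (hz₀ : z₀.Nonempty) (y₀ : Finset (Fin P)) :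
    Reach (treeCube piv S) q {(z₀, y₀, ∅)}
      {v | v ∈ S ∧ (v = (z₀, y₀, ∅) ∨ (v.2.2 = ∅ ∧ v.2.1 = y₀))} := by
  obtain ⟨i₀, hi₀, σ, hσ⟩ : ∃ i₀ ∈ z₀, ∃ σ : Equiv.Perm (Fin q), (σ i₀).val = q - 1 := by
    have hq : 0 < q := (piv z₀).pos
    refine ⟨piv z₀, hpiv _ hz₀, Equiv.swap (piv z₀) ⟨q - 1, by omega⟩, by simp⟩
  have key := Reach.of_family (G := treeCube piv S) (m := q)
    (fun i => {v : Vtx q P s | v ∈ S ∧ v.2.2 = ∅ ∧ v.2.1 = y₀ ∧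
      ∀ j : Fin q, i ≤ (σ j).val → (j ∈ v.1 ↔ j ∈ z₀)}) ?_
  · convert key using 1
    · ext ⟨z, y, a⟩
      simp only [mem_singleton_iff, Prod.mk.injEq, zero_le, forall_const, mem_ofPred_eq,
        ← Finset.ext_iff]
      constructor
      · rintro ⟨rfl, rfl, rfl⟩
        exact ⟨hS.root_mem hz₀ _, rfl, rfl, rfl⟩
      · rintro ⟨-, rfl, rfl, rfl⟩
        exact ⟨rfl, rfl, rfl⟩
    · ext ⟨z, y, a⟩
      simp only [mem_ofPred_eq, Prod.mk.injEq, (Fin.is_lt _).not_ge, false_imp_iff, implies_true,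
        and_true]
      tauto
  intro i hi
  set k : Fin q := σ.symm ⟨i, hi⟩ with hk
  have hσk : σ k = ⟨i, hi⟩ := by simp [hk]
  refine Step.of_caller ?_ (fun v => (flip k v.1, v.2)) ?_ ?_
  · rintro v ⟨hv, ha, hy, h⟩
    exact ⟨hv, ha, hy, fun j hj => h j (by omega)⟩
  · rintro ⟨z, y, a⟩ ⟨hv, rfl, rfl, h1⟩ h'
    have hz := hS.nonempty _ hv
    have h2 : ¬ (k ∈ z ↔ k ∈ z₀) := by
      intro h2
      refine h' ⟨hv, rfl, rfl, fun j hj => ?_⟩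
      rcases hj.eq_or_lt with e | hj
      · have : j = k := σ.injective (by rw [hσk]; exact Fin.ext e.symm)
        rwa [this]
      · exact h1 j hj
    have h3 : ∀ j : Fin q, i ≤ (σ j).val → (j ∈ flip k z ↔ j ∈ z₀) := by
      intro j hj
      rw [mem_flip]
      by_cases e : j = k
      · subst e
        tauto
      · have hne : (σ j).val ≠ i := fun e' =>
          e (σ.injective (by rw [hσk]; exact Fin.ext e'))
        have := h1 j (lt_of_le_of_ne hj hne.symm)
        simp only at this
        tauto
    have hz' : (flip k z).Nonempty := ⟨i₀, (h3 i₀ (by omega)).2 hi₀⟩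
    exact ⟨⟨hS.root_mem hz' _, rfl, rfl, h3⟩, adj_outer _ hz hz'⟩
  · rintro ⟨z, y, a⟩ - - ⟨z', y', a'⟩ - - h
    simp only [Prod.mk.injEq] at h ⊢
    exact ⟨flip_injective _ h.1, h.2⟩

/-- A non-root vertex first calls the root of its tree; then it takes over the role of the deleted
vertex `∅` of the first cube. -/
theorem reach_outer_of_nonroot (hpiv : ∀ z : Finset (Fin q), z.Nonempty → piv z ∈ z)
    (hS : IsAdmissible S) {z₀ : Finset (Fin q)} {y₀ : Finset (Fin P)} {a₀ : Finset (Fin s)}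
    (hu : (z₀, y₀, a₀) ∈ S) (ha₀ : a₀.Nonempty) :
    Reach (treeCube piv S) q {(z₀, y₀, a₀)}
      {v | v ∈ S ∧ (v = (z₀, y₀, a₀) ∨ (v.2.2 = ∅ ∧ v.2.1 = y₀))} := by
  have hz₀ := hS.nonempty _ hu
  simp only at hz₀
  have hq : 0 < q := (piv z₀).pos
  have hi₀ := hpiv _ hz₀
  set u : Vtx q P s := (z₀, y₀, a₀) with hu'
  obtain ⟨σ, hσ⟩ : ∃ σ : Equiv.Perm (Fin q), (σ (piv z₀)).val = q - 1 :=
    ⟨Equiv.swap (piv z₀) ⟨q - 1, by omega⟩, by simp⟩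
  have first : Step (treeCube piv S) {u} {u, (z₀, y₀, ∅)} := by
    refine Step.of_caller (by simp) (fun _ => u) ?_ ?_
    · rintro v (rfl | rfl) hv
      · simp at hv
      · exact ⟨rfl, adj_root hu ha₀⟩
    · rintro v (rfl | rfl) hv w (rfl | rfl) hw - <;> simp_all
  have key := Reach.of_family (G := treeCube piv S) (m := q - 1)
    (fun i => {v : Vtx q P s | v ∈ S ∧ (v = u ∨ (v.2.2 = ∅ ∧ v.2.1 = y₀ ∧
      ∀ j : Fin q, j ≠ piv z₀ → i ≤ (σ j).val →
        (j ∈ v.1 ↔ piv z₀ ∈ v.1 ∧ j ∈ z₀)))}) ?_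
  · have := (Reach.of_step first).trans (C := {v | v ∈ S ∧ (v = u ∨ (v.2.2 = ∅ ∧ v.2.1 = y₀))})
      (m' := q - 1) ?_
    · rwa [Nat.add_sub_cancel' hq] at this
    convert key using 1
    · ext ⟨z, y, a⟩
      simp only [mem_insert_iff, mem_singleton_iff, Prod.mk.injEq, zero_le, forall_const,
        mem_ofPred_eq]
      constructor
      · rintro (h | ⟨rfl, rfl, rfl⟩)
        · exact ⟨h ▸ hu, Or.inl h⟩
        · refine ⟨hS.root_mem hz₀ _, Or.inr ⟨rfl, rfl, ?_⟩⟩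
          tauto
      · rintro ⟨hv, h | ⟨rfl, rfl, h⟩⟩
        · exact Or.inl h
        · refine Or.inr ⟨?_, rfl, rfl⟩
          have hz := hS.nonempty _ hv
          obtain ⟨j, hj⟩ := hz
          simp only at hj
          have hp : piv z₀ ∈ z := by
            by_cases e : j = piv z₀
            · exact e ▸ hj
            · exact ((h j e).1 hj).1
          ext l
          by_cases e : l = piv z₀
          · simp [e, hp, hi₀]
          · simp [h l e, hp]
    · ext ⟨z, y, a⟩
      simp only [mem_ofPred_eq]
      have : ∀ j : Fin q, j ≠ piv z₀ → ¬ q - 1 ≤ (σ j).val := by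
        intro j hj h
        exact hj (σ.injective (Fin.ext (by have := (σ j).is_lt; omega)))
      refine and_congr_right fun _ => or_congr_right (and_congr_right fun _ => ?_)
      exact ⟨fun h => ⟨h, fun j hj h' => absurd h' (this j hj)⟩, fun h => h.1⟩
  intro i hi
  have hiq : i < q := by omega
  set k : Fin q := σ.symm ⟨i, hiq⟩ with hk
  have hσk : σ k = ⟨i, hiq⟩ := by simp [hk]
  have hkp : k ≠ piv z₀ := by
    intro e
    rw [← e, hσk] at hσ
    simp only at hσ
    omega
  have hflip : ∀ v : Vtx q P s, (v ∈ S ∧ (v = u ∨ (v.2.2 = ∅ ∧ v.2.1 = y₀ ∧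
      ∀ j : Fin q, j ≠ piv z₀ → i + 1 ≤ (σ j).val →
        (j ∈ v.1 ↔ piv z₀ ∈ v.1 ∧ j ∈ z₀)))) →
      ¬ (v ∈ S ∧ (v = u ∨ (v.2.2 = ∅ ∧ v.2.1 = y₀ ∧
      ∀ j : Fin q, j ≠ piv z₀ → i ≤ (σ j).val →
        (j ∈ v.1 ↔ piv z₀ ∈ v.1 ∧ j ∈ z₀)))) →
      v.2.2 = ∅ ∧ v.2.1 = y₀ ∧ ∀ j : Fin q, j ≠ piv z₀ → i ≤ (σ j).val →
        (j ∈ flip k v.1 ↔ piv z₀ ∈ flip k v.1 ∧ j ∈ z₀) := by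
    rintro ⟨z, y, a⟩ ⟨hv, h⟩ h'
    have hne : ¬ (z, y, a) = u := fun e => h' ⟨hv, Or.inl e⟩
    obtain ⟨rfl, rfl, h1⟩ := h.resolve_left hne
    simp only at h1 hne h'
    have h2 : ¬ (k ∈ z ↔ piv z₀ ∈ z ∧ k ∈ z₀) := by
      intro h2
      refine h' ⟨hv, Or.inr ⟨trivial, trivial, fun j hj hij => ?_⟩⟩
      rcases hij.eq_or_lt with e | hij
      · have : j = k := σ.injective (by rw [hσk]; exact Fin.ext e.symm)
        rwa [this]
      · exact h1 j hj hij
    refine ⟨rfl, rfl, fun j hj hij => ?_⟩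
    have hp : piv z₀ ∈ flip k z ↔ piv z₀ ∈ z := by
      rw [mem_flip]
      have := hkp.symm
      tauto
    simp only [hp]
    rw [mem_flip]
    by_cases e : j = k
    · subst e
      tauto
    · have hne : (σ j).val ≠ i := fun e' =>
        e (σ.injective (by rw [hσk]; exact Fin.ext e'))
      have := h1 j hj (lt_of_le_of_ne hij hne.symm)
      tauto
  refine Step.of_caller ?_
    (fun v => if flip k v.1 = ∅ then u else (flip k v.1, v.2)) ?_ ?_
  · rintro v ⟨hv, h⟩
    exact ⟨hv, h.imp_right fun h => ⟨h.1, h.2.1, fun j hj hij => h.2.2 j hj (by omega)⟩⟩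
  · rintro ⟨z, y, a⟩ hv hv'
    obtain ⟨ha, hy, h⟩ := hflip _ hv hv'
    have hvS := hv.1
    simp only at ha hy h ⊢
    subst ha hy
    have hz := hS.nonempty _ hvS
    split_ifs with e
    · refine ⟨⟨hu, Or.inl rfl⟩, ?_⟩
      have hzk : z = {k} := by
        rw [← flip_flip k z, e]
        simp [flip]
      rw [hzk]
      exact adj_link hu ha₀ hkp
    · have hz' := Finset.nonempty_iff_ne_empty.2 e
      exact ⟨⟨hS.root_mem hz' _, Or.inr ⟨rfl, rfl, h⟩⟩, adj_outer _ hz hz'⟩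
  · rintro ⟨z, y, a⟩ hv hv' ⟨z', y', a'⟩ hw hw' h
    obtain ⟨ha, hy, -⟩ := hflip _ hv hv'
    obtain ⟨ha', hy', -⟩ := hflip _ hw hw'
    simp only at ha hy ha' hy' h
    subst ha hy ha' hy'
    have hz : flip k z = flip k z' := by
      split_ifs at h with e e'
      · rw [e, e']
      · simp only [hu', Prod.mk.injEq] at h
        exact absurd h.2.2 ha₀.ne_empty
      · simp only [hu', Prod.mk.injEq] at h
        exact absurd h.2.2.symm ha₀.ne_empty
      · exact (Prod.mk.inj h).1
    rw [flip_injective k hz]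

theorem reach_treeCube (hpiv : ∀ z : Finset (Fin q), z.Nonempty → piv z ∈ z)
    (hS : IsAdmissible S) {u : Vtx q P s} (hu : u ∈ S) :
    Reach (treeCube piv S) (q + P + s) {u} {v | v ∈ S} := by
  obtain ⟨z₀, y₀, a₀⟩ := u
  refine (Reach.trans ?_ (reach_inner hS _ y₀)).trans (reach_tree hS (z₀, y₀, a₀))
  rcases a₀.eq_empty_or_nonempty with rfl | ha
  · exact reach_outer_of_root hpiv hS (hS.nonempty _ hu) y₀
  · exact reach_outer_of_nonroot hpiv hS hu ha

end Scheme

/-! ### The number of edges -/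

theorem card_filter_mem_le {m : ℕ} (j : Fin m) :
    ({z : Finset (Fin m) | j ∈ z} : Finset _).card ≤ 2 ^ (m - 1) := by
  have : ({z : Finset (Fin m) | j ∈ z} : Finset _) ⊆
      ((Finset.univ.erase j).powerset).image (insert j) := by
    intro z hz
    refine Finset.mem_image.2 ⟨z.erase j, ?_, Finset.insert_erase (by simpa using hz)⟩
    exact Finset.mem_powerset.2 (Finset.erase_subset_erase _ (Finset.subset_univ _))
  refine (Finset.card_le_card this).trans (Finset.card_image_le.trans ?_)
  simp

theorem card_nonempty (m : ℕ) :
    ((Finset.univ : Finset (Finset (Fin m))).erase ∅).card = 2 ^ m - 1 := by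
  simp [Finset.card_erase_of_mem]

theorem card_outerEdges_le : (outerEdges q P s).card ≤ q * ((2 ^ (q - 1) - 1) * 2 ^ P) := by
  refine (Finset.card_biUnion_le_card_mul _ _ ((2 ^ (q - 1) - 1) * 2 ^ P) fun j _ => ?_).trans
    (by simp)
  refine Finset.card_image_le.trans ?_
  rw [Finset.card_product, Finset.card_erase_of_mem (by simp), Finset.card_univ,
    Fintype.card_finset, Fintype.card_fin]
  exact Nat.mul_le_mul_right _ (Nat.sub_le_sub_right (card_filter_mem_le j) 1)

theorem card_innerEdges_le : (innerEdges q P s).card ≤ P * ((2 ^ q - 1) * 2 ^ (P - 1)) := by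
  refine (Finset.card_biUnion_le_card_mul _ _ ((2 ^ q - 1) * 2 ^ (P - 1)) fun j _ => ?_).trans
    (by simp)
  refine Finset.card_image_le.trans ?_
  rw [Finset.card_product, card_nonempty]
  exact Nat.mul_le_mul_left _ (card_filter_mem_le j)

theorem card_filter_card_le_one (s : ℕ) :
    ({a : Finset (Fin s) | a.card ≤ 1} : Finset _).card = s + 1 := by
  have : ({a : Finset (Fin s) | a.card ≤ 1} : Finset _) =
      insert ∅ (Finset.univ.image fun i : Fin s => {i}) := by
    ext a
    simp [Nat.le_one_iff_eq_zero_or_eq_one, Finset.card_eq_one, eq_comm]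
  rw [this, Finset.card_insert_of_notMem (by simp),
    Finset.card_image_of_injective _ Finset.singleton_injective]
  simp

/-- The vertices of depth at most one. -/
def shallow (q P s : ℕ) : Finset (Vtx q P s) :=
  (Finset.univ.erase ∅) ×ˢ Finset.univ ×ˢ ({a : Finset (Fin s) | a.card ≤ 1} : Finset _)

theorem card_shallow : (shallow q P s).card = (2 ^ q - 1) * 2 ^ P * (s + 1) := by
  rw [shallow, Finset.card_product, Finset.card_product, card_nonempty, card_filter_card_le_one]
  simp [mul_assoc]

theorem mem_shallow {v : Vtx q P s} : v ∈ shallow q P s ↔ v.1.Nonempty ∧ v.2.2.card ≤ 1 := by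
  simp [shallow, Finset.nonempty_iff_ne_empty]

theorem IsAdmissible.card_filter_two_le {S : Finset (Vtx q P s)} (hS : IsAdmissible S) :
    {v ∈ S | 2 ≤ v.2.2.card}.card = S.card - (2 ^ q - 1) * 2 ^ P * (s + 1) := by
  have : {v ∈ S | 2 ≤ v.2.2.card} = S \ shallow q P s := by
    ext v
    simp only [Finset.mem_filter, Finset.mem_sdiff, mem_shallow]
    refine and_congr_right fun hv => ?_
    have := hS.nonempty v hv
    simp [this, Nat.lt_iff_add_one_le]
  rw [this, Finset.card_sdiff_of_subset, card_shallow]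
  intro v hv
  exact hS.mem_of_card_le v (mem_shallow.1 hv).1 (mem_shallow.1 hv).2

theorem IsAdmissible.card_filter_nonempty {S : Finset (Vtx q P s)} (hS : IsAdmissible S) :
    {v ∈ S | v.2.2.Nonempty}.card = S.card - (2 ^ q - 1) * 2 ^ P := by
  have : {v ∈ S | v.2.2.Nonempty} =
      S \ ((Finset.univ.erase ∅) ×ˢ Finset.univ ×ˢ ({∅} : Finset (Finset (Fin s)))) := by
    ext v
    simp only [Finset.mem_filter, Finset.mem_sdiff]
    refine and_congr_right fun hv => ?_
    have := hS.nonempty v hv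
    simp only [Finset.mem_product, Finset.mem_erase, Finset.mem_univ, Finset.mem_singleton,
      this.ne_empty, Finset.nonempty_iff_ne_empty, ne_eq, not_false_eq_true, true_and, and_true]
  rw [this, Finset.card_sdiff_of_subset, Finset.card_product, Finset.card_product, card_nonempty]
  · simp
  rintro ⟨z, y, a⟩ hv
  simp only [Finset.mem_product, Finset.mem_erase, Finset.mem_univ, Finset.mem_singleton] at hv
  obtain ⟨⟨hz, -⟩, -, rfl⟩ := hv
  exact hS.root_mem (Finset.nonempty_iff_ne_empty.2 hz) y

theorem IsAdmissible.card_allEdges_le {piv : Finset (Fin q) → Fin q} {S : Finset (Vtx q P s)}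
    (hS : IsAdmissible S) :
    (allEdges piv S).card ≤ (S.card - (2 ^ q - 1) * 2 ^ P) +
      (S.card - (2 ^ q - 1) * 2 ^ P * (s + 1)) + (S.card - (2 ^ q - 1) * 2 ^ P) * (q - 1) +
      q * ((2 ^ (q - 1) - 1) * 2 ^ P) + P * ((2 ^ q - 1) * 2 ^ (P - 1)) := by
  have h1 : (treeEdges S).card ≤ S.card - (2 ^ q - 1) * 2 ^ P :=
    Finset.card_image_le.trans hS.card_filter_nonempty.le
  have h2 : (shortcutEdges S).card ≤ S.card - (2 ^ q - 1) * 2 ^ P * (s + 1) :=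
    Finset.card_image_le.trans hS.card_filter_two_le.le
  have h3 : (linkEdges piv S).card ≤ (S.card - (2 ^ q - 1) * 2 ^ P) * (q - 1) := by
    rw [← hS.card_filter_nonempty]
    refine Finset.card_biUnion_le_card_mul _ _ _ fun v _ => Finset.card_image_le.trans ?_
    simp [Finset.card_erase_of_mem]
  have h4 := card_outerEdges_le (q := q) (P := P) (s := s)
  have h5 := card_innerEdges_le (q := q) (P := P) (s := s)
  rw [allEdges]
  refine (Finset.card_union_le _ _).trans (add_le_add ?_ h5)
  refine (Finset.card_union_le _ _).trans (add_le_add ?_ h4)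
  refine (Finset.card_union_le _ _).trans (add_le_add ?_ h3)
  exact (Finset.card_union_le _ _).trans (add_le_add h1 h2)

/-! ### Existence -/

theorem exists_isAdmissible {n : ℕ} (h₁ : (2 ^ q - 1) * 2 ^ P * (s + 1) ≤ n)
    (h₂ : n ≤ (2 ^ q - 1) * 2 ^ P * 2 ^ s) :
    ∃ S : Finset (Vtx q P s), IsAdmissible S ∧ S.card = n := by
  suffices h : ∃ S : Finset (Vtx q P s), shallow q P s ⊆ S ∧ (∀ v ∈ S, v.1.Nonempty) ∧
      (∀ v ∈ S, ∀ w : Vtx q P s, w.1.Nonempty → w.2.2.card < v.2.2.card → w ∈ S) ∧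
      S.card = n by
    obtain ⟨S, hsub, hne, hcl, hcard⟩ := h
    refine ⟨S, ⟨hne, fun v hv hv' => hsub (mem_shallow.2 ⟨hv, hv'⟩), fun v hv j => ?_⟩, hcard⟩
    by_cases hj : j ∈ v.2.2
    · exact hcl v hv _ (hne v hv) (Finset.card_erase_lt_of_mem hj)
    · rwa [Finset.erase_eq_of_notMem hj]
  induction n, h₁ using Nat.le_induction with
  | base =>
    refine ⟨shallow q P s, subset_rfl, fun v hv => (mem_shallow.1 hv).1, fun v hv w hw h => ?_,
      card_shallow⟩
    exact mem_shallow.2 ⟨hw, h.le.trans (mem_shallow.1 hv).2⟩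
  | succ n hn ih =>
    obtain ⟨S, hsub, hne, hcl, hcard⟩ := ih (by omega)
    set U : Finset (Vtx q P s) := (Finset.univ.erase ∅) ×ˢ Finset.univ ×ˢ Finset.univ with hU
    have hUmem : ∀ v : Vtx q P s, v ∈ U ↔ v.1.Nonempty := by
      intro v
      simp [hU, Finset.nonempty_iff_ne_empty]
    have hUcard : U.card = (2 ^ q - 1) * 2 ^ P * 2 ^ s := by
      rw [hU, Finset.card_product, Finset.card_product, card_nonempty]
      simp [mul_assoc]
    have hdiff : (U \ S).Nonempty := by
      rw [← Finset.card_pos]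
      have := Finset.le_card_sdiff S U
      omega
    obtain ⟨v, hv, hmin⟩ := Finset.exists_min_image (U \ S) (fun v => v.2.2.card) hdiff
    rw [Finset.mem_sdiff, hUmem] at hv
    refine ⟨insert v S, hsub.trans (Finset.subset_insert _ _), ?_, ?_, ?_⟩
    · intro w hw
      rcases Finset.mem_insert.1 hw with rfl | hw
      · exact hv.1
      · exact hne w hw
    · intro w hw x hx hxw
      by_contra hxS
      rw [Finset.mem_insert, not_or] at hxS
      rcases Finset.mem_insert.1 hw with rfl | hw
      · have := hmin x (Finset.mem_sdiff.2 ⟨(hUmem x).2 hx, hxS.2⟩)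
        omega
      · exact hxS.2 (hcl w hw x hx hxw)
    · rw [Finset.card_insert_of_notMem hv.2, hcard]

/-- There is a broadcast graph on `n` vertices made from `(2 ^ q - 1) * 2 ^ P` binomial trees of
dimension `s`. -/
theorem exists_isBroadcastGraph {t n : ℕ} (hq : 0 < q) (ht : q + P + s = t + 1) (hn : 2 ^ t < n)
    (h₁ : (2 ^ q - 1) * 2 ^ P * (s + 1) ≤ n) (h₂ : n ≤ (2 ^ q - 1) * 2 ^ P * 2 ^ s) :
    ∃ G : SimpleGraph (Fin n), IsBroadcastGraph G ∧
      G.edgeSet.ncard ≤ (n - (2 ^ q - 1) * 2 ^ P) + (n - (2 ^ q - 1) * 2 ^ P * (s + 1)) +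
        (n - (2 ^ q - 1) * 2 ^ P) * (q - 1) + q * ((2 ^ (q - 1) - 1) * 2 ^ P) +
        P * ((2 ^ q - 1) * 2 ^ (P - 1)) := by
  obtain ⟨S, hS, rfl⟩ := exists_isAdmissible h₁ h₂
  obtain ⟨piv, hpiv⟩ : ∃ piv : Finset (Fin q) → Fin q, ∀ z, z.Nonempty → piv z ∈ z :=
    ⟨fun z => if h : z.Nonempty then z.min' h else ⟨0, hq⟩, fun z hz => by
      simpa only [dif_pos hz] using z.min'_mem hz⟩
  let e : Fin S.card ↪ Vtx q P s := S.equivFin.symm.toEmbedding.trans (Function.Embedding.subtype _)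
  have he : range e = {v | v ∈ S} := by
    ext v
    constructor
    · rintro ⟨i, rfl⟩
      exact (S.equivFin.symm i).2
    · intro hv
      exact ⟨S.equivFin ⟨v, hv⟩, by simp [e]⟩
  have hclog : Nat.clog 2 S.card = q + P + s := by
    rw [ht]
    refine le_antisymm (Nat.clog_le_of_le_pow ?_) ((Nat.lt_clog_iff_pow_lt one_lt_two).2 hn)
    rw [← ht, pow_add, pow_add]
    exact h₂.trans (by gcongr; exact Nat.sub_le _ _)
  refine ⟨(treeCube piv S).comap e,
    IsBroadcastGraph.of_completesIn (Nat.zero_lt_of_lt hn) fun u => ?_, ?_⟩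
  · rw [hclog]
    refine Reach.completesIn_comap e ?_
    rw [he]
    exact reach_treeCube hpiv hS (S.equivFin.symm u).2
  · refine le_trans ?_ (hS.card_allEdges_le (piv := piv))
    refine le_trans ?_ (Set.ncard_coe_finset (allEdges piv S)).le
    refine Set.ncard_le_ncard_of_injOn (Sym2.map e) ?_
      (Sym2.map.injective e.injective).injOn (Finset.finite_toSet _)
    intro x hx
    induction x with
    | _ a b =>
      rw [SimpleGraph.mem_edgeSet, SimpleGraph.comap_adj, treeCube,
        SimpleGraph.fromEdgeSet_adj] at hx
      exact hx.1

theorem B_le {t n : ℕ} (hq : 0 < q) (ht : q + P + s = t + 1) (hn : 2 ^ t < n)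
    (h₁ : (2 ^ q - 1) * 2 ^ P * (s + 1) ≤ n) (h₂ : n ≤ (2 ^ q - 1) * 2 ^ P * 2 ^ s) :
    (sizes n).Nonempty ∧ (B n : ℝ) ≤ (q + 1) * n - (q + 1 + s) * ((2 ^ q - 1) * 2 ^ P) +
      q * (2 ^ q / 2 - 1) * 2 ^ P + P / 2 * ((2 ^ q - 1) * 2 ^ P) := by
  obtain ⟨G, hG, hcard⟩ := exists_isBroadcastGraph hq ht hn h₁ h₂
  refine ⟨⟨_, G, hG, rfl⟩, ?_⟩
  have hB : B n ≤ G.edgeSet.ncard := Nat.sInf_le ⟨G, hG, rfl⟩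
  have hB' := (Nat.cast_le (α := ℝ)).2 (hB.trans hcard)
  refine hB'.trans (le_of_eq ?_)
  have h₀ : (2 ^ q - 1) * 2 ^ P ≤ n := le_trans (Nat.le_mul_of_pos_right _ (by omega)) h₁
  have hc : ∀ m : ℕ, ((2 ^ m - 1 : ℕ) : ℝ) = 2 ^ m - 1 := fun m => by
    rw [Nat.cast_sub Nat.one_le_two_pow]; simp
  have hP : (P : ℝ) * 2 ^ (P - 1) = P / 2 * 2 ^ P := by
    cases P with
    | zero => simp
    | succ P => rw [Nat.add_sub_cancel, pow_succ]; ring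
  obtain ⟨r, rfl⟩ : ∃ r, q = r + 1 := ⟨q - 1, by omega⟩
  push_cast [Nat.cast_sub h₀, Nat.cast_sub h₁, hc, Nat.add_sub_cancel]
  have : (P : ℝ) * ((2 ^ (r + 1) - 1) * 2 ^ (P - 1)) = (2 ^ (r + 1) - 1) * (P * 2 ^ (P - 1)) := by
    ring
  rw [this, hP]
  ring

/-! ### Numerical bounds -/

theorem shallow_le {q P s t n : ℕ} (ht : q + P + s = t + 1) (hs : 3 ≤ s) (hn : 2 ^ t < n) :
    (2 ^ q - 1) * 2 ^ P * (s + 1) ≤ n := by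
  have h : ∀ m, 3 ≤ m → m + 1 ≤ 2 ^ (m - 1) := by
    intro m hm
    induction m, hm using Nat.le_induction with
    | base => norm_num
    | succ m hm ih =>
      obtain ⟨r, rfl⟩ : ∃ r, m = r + 1 := ⟨m - 1, by omega⟩
      simp only [Nat.add_sub_cancel] at ih ⊢
      rw [pow_succ]
      omega
  calc (2 ^ q - 1) * 2 ^ P * (s + 1) ≤ 2 ^ q * 2 ^ P * 2 ^ (s - 1) := by
        gcongr
        · exact Nat.sub_le _ _
        · exact h s hs
    _ = 2 ^ t := by rw [← pow_add, ← pow_add]; congr 1; omega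
    _ ≤ n := hn.le

theorem B_le_of_le {t k n : ℕ} (hk : 0 < k) (hkt : k + 2 ≤ t) (hn : 2 ^ t < n)
    (hnN : n ≤ (2 ^ k - 1) * 2 ^ (t + 1 - k)) :
    (sizes n).Nonempty ∧
      (B n : ℝ) ≤ ((k : ℝ) + 1) * n - ((t : ℝ) - (k : ℝ) / 2 + 2) * 2 ^ k + t - k + 2 := by
  have ht : k + 0 + (t + 1 - k) = t + 1 := by omega
  obtain ⟨h, hB⟩ := B_le hk ht hn (shallow_le ht (by omega) hn) (by simpa using hnN)
  refine ⟨h, hB.trans (le_of_eq ?_)⟩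
  rw [Nat.cast_sub (by omega)]
  push_cast
  ring

theorem size_bound {t p q Q Z : ℝ} (hp : 1 ≤ p) (hq : 2 ≤ q) (ht : 2 * (p + q) + 1 ≤ t)
    (hQ : 4 ≤ Q) (hZ : 0 ≤ Z) :
    (t - (p + q) / 2 + p + 2) * (Q * Z) - (t - (p + q)) + (p - 2) * Z ≤
      (t - p - 1) * ((Q - 1) * (8 * Z)) - q * (Q / 2 - 1) * (8 * Z)
        - (p + 3) / 2 * ((Q - 1) * (8 * Z)) := by
  have h : (t - (p + q) / 2 + p + 2) * Q + (p - 2) ≤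
      8 * ((t - p - 1) * (Q - 1) - q * (Q / 2 - 1) - (p + 3) / 2 * (Q - 1)) := by
    have h1 : 0 ≤ (Q - 4) * (2 * (t - 3 / 2 * p - q / 2 - 5 / 2)) :=
      mul_nonneg (by linarith) (by linarith)
    have h2 : 0 ≤ (Q - 4) * p := mul_nonneg (by linarith) (by linarith)
    have h3 : 0 ≤ Q * (5 * t - 39 / 4 * p - 5 / 2 * q - 17) :=
      mul_nonneg (by linarith) (by linarith)
    linarith
  have := mul_le_mul_of_nonneg_right h hZ
  linarith

theorem B_le_of_pos {t p q n : ℕ} (hp : 1 ≤ p) (hq : 2 ≤ q) (ht7 : 7 ≤ t)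
    (ht : 2 * (p + q) + 1 ≤ t) (hn : 2 ^ t < n) (hnN : n ≤ (2 ^ q - 1) * 2 ^ (t + 1 - q)) :
    (sizes n).Nonempty ∧
      (B n : ℝ) ≤ (q + 1) * n - ((t : ℝ) - (p + q) / 2 + p + 2) * 2 ^ (p + q) + t - (p + q)
        - ((p : ℝ) - 2) * 2 ^ p := by
  have hmul : ∀ {P s : ℕ}, q + P + s = t + 1 → n ≤ (2 ^ q - 1) * 2 ^ P * 2 ^ s := by
    intro P s h
    rwa [mul_assoc, ← pow_add, show P + s = t + 1 - q by omega]
  by_cases h7 : t = 7 ∧ p = 1 ∧ q = 2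
  · obtain ⟨rfl, rfl, rfl⟩ := h7
    have ht' : 2 + 3 + 3 = 7 + 1 := by norm_num
    obtain ⟨h, hB⟩ := B_le (by norm_num) ht' hn (shallow_le ht' (by norm_num) hn) (hmul ht')
    refine ⟨h, hB.trans ?_⟩
    norm_num
    linarith
  · have ht' : q + (p + 3) + (t - (p + q) - 2) = t + 1 := by omega
    obtain ⟨h, hB⟩ := B_le (by omega) ht' hn (shallow_le ht' (by omega) hn) (hmul ht')
    refine ⟨h, hB.trans ?_⟩
    have hQ : (4 : ℝ) ≤ 2 ^ q := by
      calc (4 : ℝ) = 2 ^ 2 := by norm_num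
        _ ≤ 2 ^ q := pow_le_pow_right₀ (by norm_num) hq
    have key := size_bound (t := t) (p := p) (q := q) (Q := 2 ^ q) (Z := 2 ^ p)
      (by exact_mod_cast hp) (by exact_mod_cast hq) (by exact_mod_cast ht) hQ (by positivity)
    have hs : ((t - (p + q) - 2 : ℕ) : ℝ) = t - (p + q) - 2 := by
      rw [Nat.cast_sub (by omega), Nat.cast_sub (by omega)]
      push_cast
      ring
    have h8 : (2 : ℝ) ^ (p + 3) = 8 * 2 ^ p := by rw [pow_add]; ring
    have hk : (2 : ℝ) ^ (p + q) = 2 ^ q * 2 ^ p := by rw [pow_add]; ring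
    rw [hs, h8, hk]
    push_cast
    linarith

end Broadcast

theorem theorem1p2 (t k n N : ℕ) (ht : 7 ≤ t) (hk2 : 2 ≤ k)
    (hk : k ≤ t / 2 - 1 ∨ (Odd n ∧ k ≤ (t + 1) / 2 - 1))
    (hN : N = (2 ^ k - 1) * 2 ^ (t + 1 - k)) :
    (n = N →
      (Broadcast.sizes n).Nonempty ∧
      (Broadcast.B n : ℝ) ≤
        ((k : ℝ) + 1) * N - ((t : ℝ) - (k : ℝ) / 2 + 2) * 2 ^ k + t - k + 2) ∧
    (2 ^ t < n → n < N → ∀ d x p : ℕ,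
      d = N - n → x = d / 2 ^ (t + 1 - k) → p = (if 0 < x then Nat.log 2 (x + 1) else 0) →
      (Broadcast.sizes n).Nonempty ∧
      (Broadcast.B n : ℝ) ≤
        ((k : ℝ) + 1 - p) * n - ((t : ℝ) - (k : ℝ) / 2 + p + 2) * 2 ^ k + t - k
          - ((p : ℝ) - 2) * 2 ^ p) := by
  have hkt : 2 * k + 1 ≤ t := by omega
  have hpow : 2 ^ (k - 1) * 2 ^ (t + 1 - k) = 2 ^ t := by rw [← pow_add]; congr 1; omega
  have hN' : N + 2 ^ (t + 1 - k) = 2 * 2 ^ t := by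
    have h1 : 2 ^ k * 2 ^ (t + 1 - k) = 2 * 2 ^ t := by
      rw [← pow_add, ← pow_succ']; congr 1; omega
    have h2 := Nat.mul_le_mul_right (2 ^ (t + 1 - k)) (Nat.one_le_two_pow (n := k))
    rw [hN, Nat.sub_mul]
    omega
  constructor
  · rintro rfl
    refine Broadcast.B_le_of_le (by omega) (by omega) ?_ hN.le
    have : 2 ^ (t + 1 - k) < 2 ^ t := Nat.pow_lt_pow_right one_lt_two (by omega)
    omega
  · intro hn hnN d x p hd hx hp
    have hp : p = Nat.log 2 (x + 1) := by
      rw [hp]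
      split_ifs with h
      · rfl
      · simp [Nat.eq_zero_of_not_pos h]
    rcases Nat.eq_zero_or_pos p with h0 | h0
    · obtain ⟨h, hB⟩ := Broadcast.B_le_of_le (by omega : 0 < k) (by omega) hn (hN ▸ hnN.le)
      refine ⟨h, hB.trans (le_of_eq ?_)⟩
      rw [h0]
      push_cast
      ring
    have hpx : 2 ^ p ≤ x + 1 := hp ▸ Nat.pow_log_le_self 2 (by omega)
    have hxd : x * 2 ^ (t + 1 - k) ≤ d := hx ▸ Nat.div_mul_le_self _ _
    have hpk : p < k - 1 := by
      have h1 : (x + 1) * 2 ^ (t + 1 - k) < 2 ^ (k - 1) * 2 ^ (t + 1 - k) := by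
        rw [add_mul, one_mul]
        omega
      have h2 := Nat.lt_of_mul_lt_mul_right h1
      exact (Nat.pow_lt_pow_iff_right one_lt_two).1 (hpx.trans_lt h2)
    obtain ⟨q, rfl⟩ : ∃ q, k = p + q := ⟨k - p, by omega⟩
    obtain ⟨h, hB⟩ := Broadcast.B_le_of_pos (q := q) h0 (by omega) ht hkt hn (by
      have h1 := Nat.mul_le_mul_right (2 ^ (t + 1 - (p + q))) hpx
      have h2 : 2 ^ p * 2 ^ (t + 1 - (p + q)) = 2 ^ (t + 1 - q) := by
        rw [← pow_add]; congr 1; omega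
      have h3 : 2 ^ q * 2 ^ (t + 1 - q) = 2 * 2 ^ t := by
        rw [← pow_add, ← pow_succ']; congr 1; omega
      rw [add_mul, one_mul] at h1
      rw [Nat.sub_mul]
      omega)
    refine ⟨h, hB.trans (le_of_eq ?_)⟩
    push_cast
    ring
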